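/- A \emph{fullerene graph} is a finite connected simple cubic plane graph each of whose faces has length 5 or 6. Two distinct faces are neighbours if they share an edge, and the \emph{facial distance} of two faces is their distance in the dual graph (so neighbouring faces are at facial distance 1). A \emph{drum} is a fullerene graph with two specified 6-faces $F$ and $F'$, each of which is a neighbour of six 5-faces, such that these twelve 5-faces are all distinct. For a non-negative integer $k$, a \emph{$k$-drum} is a drum in which $F$ and $F'$ are at facial distance $k+1$. Proposition. Let $G$ be a $k$-drum with specified 6-faces $F$ and $F'$. Then for every integer $\ell$ with $0\le \ell\le k$, all faces of $G$ at facial distance $\ell$ from $F$ have the same length. -/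

import Mathlib

/-- A rotation system on a graph: a permutation of the darts (oriented edges) which, around
each vertex `v`, permutes the darts with origin `v` in one single cycle. Rotation systems are
the combinatorial description of the cellular embeddings of `G` in oriented surfaces. -/
structure RotationSystem {V : Type*} (G : SimpleGraph V) where
  /-- the next dart around the origin of a dart -/
  rot : Equiv.Perm G.Dart
  rot_fst : ∀ d : G.Dart, (rot d).fst = d.fst
  rot_sameCycle : ∀ d e : G.Dart, d.fst = e.fst → rot.SameCycle d e

namespace RotationSystem

/-- Face tracing: traverse the dart `d`, then continue with the dart that comes after the
reversed dart in the rotation at the endpoint of `d`. -/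
def facePerm {V : Type*} {G : SimpleGraph V} (R : RotationSystem G) : Equiv.Perm G.Dart :=
  (Function.Involutive.toPerm SimpleGraph.Dart.symm SimpleGraph.Dart.symm_involutive).trans R.rot

/-- The faces of the embedding: the orbits of face tracing. -/
def Face {V : Type*} {G : SimpleGraph V} (R : RotationSystem G) : Type _ :=
  Quotient (Equiv.Perm.SameCycle.setoid R.facePerm)

/-- The face that is traced by a dart. -/
def faceOf {V : Type*} {G : SimpleGraph V} (R : RotationSystem G) (d : G.Dart) : R.Face :=
  Quotient.mk (Equiv.Perm.SameCycle.setoid R.facePerm) d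

/-- The length of a face: the number of darts on its boundary walk. -/
noncomputable def faceLength {V : Type*} {G : SimpleGraph V} (R : RotationSystem G)
    (f : R.Face) : ℕ :=
  {d : G.Dart | R.faceOf d = f}.ncard

/-- The (simple) dual graph: two distinct faces are neighbours when they share an edge. -/
def dual {V : Type*} {G : SimpleGraph V} (R : RotationSystem G) : SimpleGraph R.Face where
  Adj f g := f ≠ g ∧ ∃ d : G.Dart, R.faceOf d = f ∧ R.faceOf d.symm = g
  symm := ⟨fun _ _ h => ⟨h.1.symm, h.2.elim fun d hd =>
    ⟨d.symm, hd.2, by rw [SimpleGraph.Dart.symm_symm]; exact hd.1⟩⟩⟩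
  loopless := ⟨fun _ h => h.1 rfl⟩

/-- The facial distance: the distance in the dual graph, so that distinct faces that share an
edge are at distance `1`. -/
noncomputable def facialDist {V : Type*} {G : SimpleGraph V} (R : RotationSystem G)
    (f g : R.Face) : ℕ :=
  R.dual.dist f g

/-- The rotation system of a finite connected graph (with at least one edge) describes an
embedding in the sphere, that is, a plane graph: its Euler characteristic is `2`. -/
def IsPlane {V : Type*} {G : SimpleGraph V} (R : RotationSystem G) : Prop :=
  G.Connected ∧ (Nat.card V : ℤ) - (Nat.card G.edgeSet : ℤ) + (Nat.card R.Face : ℤ) = 2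

/-- A fullerene graph, with its plane embedding: a (connected) cubic plane graph each of whose
faces is of length `5` or `6`. -/
structure IsFullerene {V : Type*} [Fintype V] {G : SimpleGraph V} [DecidableRel G.Adj]
    (R : RotationSystem G) : Prop where
  plane : R.IsPlane
  cubic : G.IsRegularOfDegree 3
  faceLength_eq : ∀ f : R.Face, R.faceLength f = 5 ∨ R.faceLength f = 6

/-- The set of the `5`-faces that are neighbours of the face `F`. -/
def fiveFacesAround {V : Type*} {G : SimpleGraph V} (R : RotationSystem G) (F : R.Face) :
    Set R.Face :=
  {f | R.dual.Adj F f ∧ R.faceLength f = 5}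

/-- A drum with distinguished faces `F` and `F'`: a fullerene graph in which `F` and `F'` are
`6`-faces, each of them is a neighbour of six `5`-faces, and these twelve `5`-faces are
distinct. -/
structure IsDrum {V : Type*} [Fintype V] {G : SimpleGraph V} [DecidableRel G.Adj]
    (R : RotationSystem G) (F F' : R.Face) : Prop where
  fullerene : R.IsFullerene
  length_left : R.faceLength F = 6
  length_right : R.faceLength F' = 6
  card_left : (R.fiveFacesAround F).ncard = 6
  card_right : (R.fiveFacesAround F').ncard = 6
  disjoint : Disjoint (R.fiveFacesAround F) (R.fiveFacesAround F')

/-- A `k`-drum: a drum whose distinguished faces are at facial distance `k + 1`. -/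
structure IsKDrum {V : Type*} [Fintype V] {G : SimpleGraph V} [DecidableRel G.Adj]
    (R : RotationSystem G) (k : ℕ) (F F' : R.Face) : Prop where
  drum : R.IsDrum F F'
  dist_eq : R.facialDist F F' = k + 1

end RotationSystem

/-!
By Euler's formula a fullerene graph has exactly twelve 5-faces, so in a drum each of them is a
neighbour of `F` or of `F'`. The faces around `F` form concentric layers: six pentagons, then rings
of six hexagons, as long as no further pentagon is met. The boundary of a layer is an orbit of a
shift, and reversal of darts conjugates this shift to its inverse. Hence, if a layer folded back
onto an earlier one, their boundaries would be glued along a reflection; such a reflection fixes an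
edge or a vertex, which is impossible. Consequently a pentagon outside the first layer is a
neighbour of `F'` and lies in the `k`-th layer or further out, and the layers 2, ..., `k - 1`
consist of hexagons. Some face of the `k`-th layer is a neighbour of `F'`, hence a pentagon, and
its being a pentagon forces the next face of the layer to be a neighbour of `F'` as well. So all
the faces of the `k`-th layer are pentagons.
-/

namespace RotationSystem

open SimpleGraph.Dart (symm_symm)

variable {V : Type*} {G : SimpleGraph V} (R : RotationSystem G)

/-! ### Face tracing -/

theorem facePerm_symm (d : G.Dart) : R.facePerm d.symm = R.rot d :=
  congrArg R.rot (symm_symm d)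

theorem faceOf_eq_iff {d e : G.Dart} : R.faceOf d = R.faceOf e ↔ R.facePerm.SameCycle d e :=
  Quotient.eq

theorem faceOf_surjective : Function.Surjective R.faceOf :=
  Quotient.mk_surjective

@[simp]
theorem faceOf_facePerm (d : G.Dart) : R.faceOf (R.facePerm d) = R.faceOf d :=
  R.faceOf_eq_iff.2 (Equiv.Perm.sameCycle_apply_left.2 .rfl)

@[simp]
theorem faceOf_facePerm_inv (d : G.Dart) : R.faceOf (R.facePerm.symm d) = R.faceOf d :=
  R.faceOf_eq_iff.2 (Equiv.Perm.sameCycle_symm_apply_left.2 .rfl)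

theorem faceOf_facePerm_zpow (i : ℤ) (d : G.Dart) :
    R.faceOf ((R.facePerm ^ i) d) = R.faceOf d :=
  R.faceOf_eq_iff.2 (Equiv.Perm.sameCycle_zpow_left.2 .rfl)

theorem facePerm_isCycleOn (f : R.Face) : R.facePerm.IsCycleOn {d | R.faceOf d = f} := by
  refine ⟨R.facePerm.bijOn fun d => ?_, fun d hd e he => R.faceOf_eq_iff.1 (hd.trans he.symm)⟩
  simp only [Set.mem_ofPred_eq, faceOf_facePerm]

variable {R} in
theorem iterate_facePerm_eq_self_iff {d : G.Dart} {n i : ℕ} [NeZero n]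
    (h : R.faceLength (R.faceOf d) = n) : R.facePerm^[i] d = d ↔ n ∣ i := by
  have hfin := Set.finite_of_ncard_ne_zero (h.trans_ne (NeZero.ne n))
  have hcycle := R.facePerm_isCycleOn (R.faceOf d)
  rw [← hfin.coe_toFinset] at hcycle
  rw [Equiv.Perm.iterate_eq_pow, hcycle.pow_apply_eq (hfin.mem_toFinset.2 rfl),
    ← Set.ncard_eq_toFinset_card _ hfin]
  exact iff_of_eq (congrArg (· ∣ i) h)

variable {R} in
theorem exists_iterate_facePerm_eq {d e : G.Dart} {n : ℕ} [NeZero n]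
    (h : R.faceLength (R.faceOf d) = n) (he : R.faceOf e = R.faceOf d) :
    ∃ i < n, R.facePerm^[i] d = e := by
  have hfin := Set.finite_of_ncard_ne_zero (h.trans_ne (NeZero.ne n))
  have hcycle := R.facePerm_isCycleOn (R.faceOf d)
  rw [← hfin.coe_toFinset] at hcycle
  obtain ⟨i, hi, rfl⟩ := hcycle.exists_pow_eq (hfin.mem_toFinset.2 rfl) (hfin.mem_toFinset.2 he)
  rw [← Set.ncard_eq_toFinset_card _ hfin] at hi
  exact ⟨i, hi.trans_eq h, by rw [Equiv.Perm.iterate_eq_pow]⟩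

section

variable {R} {d e : G.Dart}

theorem facePerm_inv_eq_of_faceLength_eq_five (h : R.faceLength (R.faceOf d) = 5) :
    R.facePerm.symm d = R.facePerm (R.facePerm (R.facePerm (R.facePerm d))) :=
  (Equiv.symm_apply_eq _).2 ((iterate_facePerm_eq_self_iff (i := 5) h).2 dvd_rfl).symm

theorem facePerm_inv_eq_of_faceLength_eq_six (h : R.faceLength (R.faceOf d) = 6) :
    R.facePerm.symm d =
      R.facePerm (R.facePerm (R.facePerm (R.facePerm (R.facePerm d)))) :=
  (Equiv.symm_apply_eq _).2 ((iterate_facePerm_eq_self_iff (i := 6) h).2 dvd_rfl).symm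

theorem eq_or_of_faceLength_eq_five (h : R.faceLength (R.faceOf d) = 5)
    (he : R.faceOf e = R.faceOf d) :
    e = d ∨ e = R.facePerm d ∨ e = R.facePerm (R.facePerm d) ∨
      e = R.facePerm (R.facePerm (R.facePerm d)) ∨ e = R.facePerm.symm d := by
  rw [facePerm_inv_eq_of_faceLength_eq_five h]
  obtain ⟨i, hi, rfl⟩ := exists_iterate_facePerm_eq h he
  interval_cases i <;> simp

theorem eq_or_of_faceLength_eq_six (h : R.faceLength (R.faceOf d) = 6)
    (he : R.faceOf e = R.faceOf d) :
    e = d ∨ e = R.facePerm d ∨ e = R.facePerm (R.facePerm d) ∨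
      e = R.facePerm (R.facePerm (R.facePerm d)) ∨
      e = R.facePerm (R.facePerm (R.facePerm (R.facePerm d))) ∨ e = R.facePerm.symm d := by
  rw [facePerm_inv_eq_of_faceLength_eq_six h]
  obtain ⟨i, hi, rfl⟩ := exists_iterate_facePerm_eq h he
  interval_cases i <;> simp

end

/-! ### The dual graph -/

theorem faceOf_eq_or_dual_adj (d : G.Dart) :
    R.faceOf d = R.faceOf d.symm ∨ R.dual.Adj (R.faceOf d) (R.faceOf d.symm) :=
  or_iff_not_imp_left.2 fun h => ⟨h, d, rfl, rfl⟩

theorem dual_reachable_symm (d : G.Dart) :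
    R.dual.Reachable (R.faceOf d) (R.faceOf d.symm) := by
  rcases R.faceOf_eq_or_dual_adj d with h | h
  · rw [h]
  · exact h.reachable

theorem dual_reachable_rot (d : G.Dart) : R.dual.Reachable (R.faceOf d) (R.faceOf (R.rot d)) := by
  rw [← R.facePerm_symm, faceOf_facePerm]
  exact R.dual_reachable_symm d

theorem dual_reachable_of_fst_eq {d e : G.Dart} (h : d.fst = e.fst) :
    R.dual.Reachable (R.faceOf d) (R.faceOf e) := by
  obtain ⟨i, rfl⟩ := R.rot_sameCycle d e h
  clear h
  induction i using Int.induction_on with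
  | zero => rfl
  | succ i ih =>
    rw [add_comm, zpow_one_add, Equiv.Perm.mul_apply]
    exact ih.trans (R.dual_reachable_rot _)
  | pred i ih =>
    refine ih.trans (SimpleGraph.Reachable.symm ?_)
    convert R.dual_reachable_rot ((R.rot ^ (-(i : ℤ) - 1)) d) using 2
    rw [← Equiv.Perm.mul_apply, ← zpow_one_add, add_sub_cancel]

theorem dual_reachable_of_walk {u v : V} (w : G.Walk u v) :
    ∀ d e : G.Dart, d.fst = u → e.fst = v → R.dual.Reachable (R.faceOf d) (R.faceOf e) := by
  induction w with
  | nil => exact fun d e hd he => R.dual_reachable_of_fst_eq (hd.trans he.symm)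
  | @cons u v _ huv _ ih =>
    intro d e hd he
    let c : G.Dart := ⟨(u, v), huv⟩
    exact (R.dual_reachable_of_fst_eq (e := c) hd).trans
      ((R.dual_reachable_symm c).trans (ih c.symm e rfl he))

theorem dual_preconnected (hG : G.Preconnected) : R.dual.Preconnected := by
  intro f g
  obtain ⟨d, rfl⟩ := R.faceOf_surjective f
  obtain ⟨e, rfl⟩ := R.faceOf_surjective g
  exact R.dual_reachable_of_walk (hG d.fst e.fst).some d e rfl rfl

/-! ### Regularity and counting -/

theorem rot_pow_eq_one_of_isRegularOfDegree [Fintype V] [DecidableRel G.Adj] {n : ℕ}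
    (hG : G.IsRegularOfDegree n) : R.rot ^ n = 1 := by
  classical
  ext1 d
  have hcycle : R.rot.IsCycleOn ({e | e.fst = d.fst} : Finset G.Dart) := by
    simp only [Finset.coe_filter, Finset.mem_univ, true_and]
    exact ⟨R.rot.bijOn fun e => by simp [R.rot_fst],
      fun e he e' he' => R.rot_sameCycle e e' (he.trans he'.symm)⟩
  have hpow := hcycle.pow_card_apply (a := d) (by simp)
  rwa [G.dart_fst_fiber_card_eq_degree, hG d.fst] at hpow

theorem sum_faceLength [Fintype G.Dart] [Fintype R.Face] :
    ∑ f : R.Face, R.faceLength f = Fintype.card G.Dart := by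
  classical
  rw [← Finset.card_univ, Finset.card_eq_sum_card_fiberwise
    (f := R.faceOf) (t := Finset.univ) (fun _ _ => Finset.mem_univ _)]
  refine Finset.sum_congr rfl fun f _ => ?_
  rw [faceLength, Set.ncard_eq_toFinset_card', Set.toFinset_ofPred]

variable {R} in
theorem IsFullerene.ncard_faceLength_eq_five [Fintype V] [DecidableRel G.Adj]
    (h : R.IsFullerene) : {f : R.Face | R.faceLength f = 5}.ncard = 12 := by
  classical
  have : Finite R.Face := Quotient.finite _
  have := Fintype.ofFinite R.Face
  have hdarts_edges := G.dart_card_eq_twice_card_edges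
  have hdarts_vertices : Fintype.card G.Dart = Fintype.card V * 3 := by
    simp [G.dart_card_eq_sum_degrees, h.cubic.degree_eq]
  have hdarts_faces : Fintype.card G.Dart + {f : R.Face | R.faceLength f = 5}.ncard =
      Fintype.card R.Face * 6 := by
    calc Fintype.card G.Dart + {f : R.Face | R.faceLength f = 5}.ncard
        = ∑ f : R.Face, (R.faceLength f + if R.faceLength f = 5 then 1 else 0) := by
          rw [Finset.sum_add_distrib, sum_faceLength, Finset.sum_boole,
            Set.ncard_eq_toFinset_card', Set.toFinset_ofPred, Nat.cast_id]
      _ = ∑ _f : R.Face, 6 :=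
          Finset.sum_congr rfl fun f _ => by rcases h.faceLength_eq f with hf | hf <;> simp [hf]
      _ = Fintype.card R.Face * 6 := by simp
  have heuler := h.plane.2
  simp only [Nat.card_eq_fintype_card, ← SimpleGraph.edgeFinset_card] at heuler
  lia

/-! ### Shifting along the boundary of a layer -/

/-- The translation by two edges along a closed zigzag, from which edges leave alternately to the
left and to the right: the boundary of a layer of faces around a face is an orbit. The dart
`facePerm d` follows `d` in the zigzag, and `boundaryShift d` follows `facePerm d`. -/
def boundaryShift : Equiv.Perm G.Dart :=
  R.facePerm.trans
    ((Function.Involutive.toPerm SimpleGraph.Dart.symm SimpleGraph.Dart.symm_involutive).trans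
      R.rot.symm)

/-- The dart on the far side of a hexagon that is entered across the dart `d`: from `d` on the
boundary of a layer of faces it leads to the boundary of the next layer. -/
def oppositeDart (d : G.Dart) : G.Dart :=
  R.facePerm (R.facePerm (R.facePerm d.symm))

theorem facePerm_symm_boundaryShift (d : G.Dart) :
    R.facePerm (R.boundaryShift d).symm = (R.facePerm d).symm := by
  rw [facePerm_symm]
  exact R.rot.apply_symm_apply _

theorem boundaryShift_symm_boundaryShift (d : G.Dart) :
    R.boundaryShift (R.boundaryShift d).symm = d.symm := by
  refine R.rot.symm_apply_eq.2 ?_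
  change (R.facePerm (R.boundaryShift d).symm).symm = R.rot d.symm
  rw [facePerm_symm_boundaryShift, symm_symm]
  rfl

theorem boundaryShift_inv_symm (d : G.Dart) :
    R.boundaryShift.symm d.symm = (R.boundaryShift d).symm :=
  R.boundaryShift.symm_apply_eq.2 (R.boundaryShift_symm_boundaryShift d).symm

theorem boundaryShift_symm (d : G.Dart) :
    R.boundaryShift d.symm = (R.boundaryShift.symm d).symm := by
  rw [← R.boundaryShift.eq_symm_apply, boundaryShift_inv_symm, Equiv.apply_symm_apply]

theorem boundaryShift_zpow_symm (i : ℤ) (d : G.Dart) :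
    ((R.boundaryShift ^ i) d).symm = (R.boundaryShift ^ (-i)) d.symm := by
  let reversal : Equiv.Perm G.Dart := SimpleGraph.Dart.symm_involutive.toPerm
  have h : SemiconjBy reversal R.boundaryShift R.boundaryShift⁻¹ :=
    Equiv.ext fun d => (R.boundaryShift_inv_symm d).symm
  rw [zpow_neg, ← inv_zpow]
  exact DFunLike.congr_fun (h.zpow_right i) d

theorem boundaryShift_ne_symm (d : G.Dart) : R.boundaryShift d ≠ d.symm := by
  intro h
  have h' := R.facePerm_symm_boundaryShift d
  rw [h, symm_symm] at h'
  exact SimpleGraph.Dart.symm_ne _ h'.symm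

theorem oppositeDart_boundaryShift (d : G.Dart) :
    R.oppositeDart (R.boundaryShift d) = R.facePerm (R.facePerm (R.facePerm d).symm) := by
  rw [oppositeDart, facePerm_symm_boundaryShift]

@[simp]
theorem faceOf_oppositeDart (d : G.Dart) : R.faceOf (R.oppositeDart d) = R.faceOf d.symm := by
  simp [oppositeDart]

theorem faceOf_symm_facePerm (d : G.Dart) :
    R.faceOf (R.facePerm d).symm = R.faceOf (R.boundaryShift d).symm := by
  rw [← facePerm_symm_boundaryShift, faceOf_facePerm]

section Cubic

variable {R} (hR : R.rot ^ 3 = 1)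

include hR

theorem boundaryShift_apply (d : G.Dart) :
    R.boundaryShift d = R.facePerm (R.facePerm (R.facePerm d)).symm := by
  refine R.rot.symm_apply_eq.2 ?_
  rw [facePerm_symm]
  exact (DFunLike.congr_fun hR _).symm

theorem facePerm_symm_facePerm_symm (d : G.Dart) :
    R.facePerm (R.facePerm d).symm = (R.facePerm.symm d.symm).symm := by
  rw [← symm_symm (R.facePerm _), SimpleGraph.Dart.symm_involutive.injective.eq_iff,
    Equiv.eq_symm_apply, facePerm_symm, facePerm_symm]
  exact DFunLike.congr_fun hR d.symm

theorem faceOf_symm_facePerm_facePerm (d : G.Dart) :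
    R.faceOf (R.facePerm (R.facePerm d)).symm = R.faceOf (R.boundaryShift d) := by
  rw [boundaryShift_apply hR, faceOf_facePerm]

theorem symm_facePerm_inv (d : G.Dart) :
    (R.facePerm.symm d).symm = R.facePerm (R.facePerm (R.boundaryShift.symm d)) := by
  have h := boundaryShift_apply hR (R.boundaryShift.symm d)
  rw [Equiv.apply_symm_apply, ← Equiv.symm_apply_eq] at h
  rw [h, symm_symm]

theorem faceOf_symm_facePerm_inv (d : G.Dart) :
    R.faceOf (R.facePerm.symm d).symm = R.faceOf (R.boundaryShift.symm d) := by
  rw [symm_facePerm_inv hR, faceOf_facePerm, faceOf_facePerm]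

theorem boundaryShift_eq_of_facePerm_eq {d e : G.Dart}
    (h : R.facePerm (R.facePerm (R.facePerm d)) = e.symm) :
    R.boundaryShift d = R.facePerm (R.facePerm (R.facePerm e).symm) := by
  rw [facePerm_symm_facePerm_symm hR, ← h, Equiv.symm_apply_apply, boundaryShift_apply hR]

theorem boundaryShift_ne_facePerm_facePerm_facePerm (d : G.Dart) :
    R.boundaryShift d ≠ R.facePerm (R.facePerm (R.facePerm d)) := by
  rw [boundaryShift_apply hR]
  exact fun h => SimpleGraph.Dart.symm_ne _ (R.facePerm.injective h)

theorem faceOf_symm_oppositeDart_boundaryShift {d : G.Dart}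
    (h : R.faceLength (R.faceOf d.symm) = 5) :
    R.faceOf (R.oppositeDart (R.boundaryShift d)).symm = R.faceOf (R.oppositeDart d).symm := by
  have hpentagon : R.facePerm (R.facePerm (R.oppositeDart d)) = d.symm :=
    (iterate_facePerm_eq_self_iff (i := 5) h).2 dvd_rfl
  have hshift : R.boundaryShift (R.oppositeDart d) = R.facePerm d := by
    rw [boundaryShift_apply hR, hpentagon, symm_symm]
  rw [oppositeDart_boundaryShift, faceOf_symm_facePerm_facePerm hR, boundaryShift_symm, ← hshift,
    Equiv.symm_apply_apply]

end Cubic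

/-! ### Layers around a face -/

/-- The dart of the outer boundary of the `n`-th layer around a face that one reaches by leaving
that face across its dart `d` and going straight on. The formula presumes that the first layer
consists of pentagons and the following ones of hexagons. -/
def outerDart : ℕ → G.Dart → G.Dart
  | 0, d => d
  | 1, d => R.facePerm (R.facePerm d.symm)
  | n + 2, d => R.oppositeDart (outerDart (n + 1) d)

/-- The `n`-th layer of faces around `F`, in the situation for which `outerDart` is designed. -/
def layer (F : R.Face) (n : ℕ) : Set R.Face :=
  (fun d => R.faceOf (R.outerDart n d)) '' {d | R.faceOf d = F}

/-- The layers around `F` up to the `n`-th one look like the end of a nanotube: the hexagon `F` is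
surrounded by six pentagons, and the next layers consist of hexagons. -/
structure IsCap (F : R.Face) (n : ℕ) : Prop where
  faceLength_center : R.faceLength F = 6
  ncard_fiveFacesAround : (R.fiveFacesAround F).ncard = 6
  faceLength_layer : ∀ m, 2 ≤ m → m ≤ n → ∀ f ∈ R.layer F m, R.faceLength f = 6

variable {R} in
theorem outerDart_succ {n : ℕ} (hn : n ≠ 0) (d : G.Dart) :
    R.outerDart (n + 1) d = R.oppositeDart (R.outerDart n d) := by
  obtain ⟨n, rfl⟩ := Nat.exists_eq_succ_of_ne_zero hn
  rfl

theorem faceOf_outerDart_succ (n : ℕ) (d : G.Dart) :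
    R.faceOf (R.outerDart (n + 1) d) = R.faceOf (R.outerDart n d).symm := by
  cases n <;> simp [outerDart]

theorem layer_zero (F : R.Face) : R.layer F 0 = {F} := by
  refine Set.eq_singleton_iff_nonempty_unique_mem.2 ⟨?_, fun f ⟨_, hd, hf⟩ => hf.symm.trans hd⟩
  obtain ⟨d, hd⟩ := R.faceOf_surjective F
  exact ⟨_, d, hd, rfl⟩

section

variable {R} {F f : R.Face} {n : ℕ} {d : G.Dart}

theorem faceOf_outerDart_mem_layer (hd : R.faceOf d = F) (n : ℕ) :
    R.faceOf (R.outerDart n d) ∈ R.layer F n :=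
  ⟨d, hd, rfl⟩

theorem faceOf_symm_outerDart_mem_layer (hd : R.faceOf d = F) (n : ℕ) :
    R.faceOf (R.outerDart n d).symm ∈ R.layer F (n + 1) :=
  ⟨d, hd, R.faceOf_outerDart_succ n d⟩

theorem exists_walk_of_mem_layer (hf : f ∈ R.layer F n) :
    ∃ w : R.dual.Walk f F, w.length ≤ n := by
  obtain ⟨d, rfl, rfl⟩ := hf
  induction n with
  | zero => exact ⟨.nil, le_rfl⟩
  | succ n ih =>
    obtain ⟨w, hw⟩ := ih
    beta_reduce at w ⊢
    rw [faceOf_outerDart_succ]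
    rcases R.faceOf_eq_or_dual_adj (R.outerDart n d) with h | h
    · exact ⟨w.copy h rfl, by simpa using hw.trans n.le_succ⟩
    · exact ⟨.cons h.symm w, by simpa using hw⟩

theorem fiveFacesAround_eq_image (hF : R.faceLength F ≠ 0)
    (h : (R.fiveFacesAround F).ncard = R.faceLength F) :
    R.fiveFacesAround F = (fun d => R.faceOf d.symm) '' {d | R.faceOf d = F} := by
  have hfin := Set.finite_of_ncard_ne_zero hF
  exact Set.eq_of_subset_of_ncard_le (fun _ hf => hf.1.2)
    ((Set.ncard_image_le hfin).trans h.ge) (hfin.image _)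

theorem injOn_faceOf_symm (hF : R.faceLength F ≠ 0)
    (h : (R.fiveFacesAround F).ncard = R.faceLength F) :
    Set.InjOn (fun d => R.faceOf d.symm) {d | R.faceOf d = F} :=
  Set.injOn_of_ncard_image_eq (by rw [← fiveFacesAround_eq_image hF h, h, faceLength])
    (Set.finite_of_ncard_ne_zero hF)

theorem faceLength_eq_five_of_adj (hF : R.faceLength F ≠ 0)
    (h : (R.fiveFacesAround F).ncard = R.faceLength F) (hf : R.dual.Adj F f) :
    R.faceLength f = 5 :=
  (fiveFacesAround_eq_image hF h ▸ hf.2 : f ∈ R.fiveFacesAround F).2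

end

namespace IsCap

variable {R} {F f g : R.Face} {m n : ℕ} {d e : G.Dart}

theorem faceLength_center_ne_zero (h : R.IsCap F n) : R.faceLength F ≠ 0 := by
  simp [h.faceLength_center]

theorem ncard_fiveFacesAround_eq (h : R.IsCap F n) :
    (R.fiveFacesAround F).ncard = R.faceLength F :=
  h.ncard_fiveFacesAround.trans h.faceLength_center.symm

theorem layer_one (h : R.IsCap F n) : R.layer F 1 = R.fiveFacesAround F := by
  simp only [layer, faceOf_outerDart_succ]
  exact (fiveFacesAround_eq_image h.faceLength_center_ne_zero h.ncard_fiveFacesAround_eq).symm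

theorem faceLength_eq_five_of_mem_layer_one (h : R.IsCap F n) (hf : f ∈ R.layer F 1) :
    R.faceLength f = 5 :=
  (h.layer_one ▸ hf).2

theorem faceLength_outerDart (h : R.IsCap F n) (hm : m ≠ 0) (hmn : m ≤ n)
    (hd : R.faceOf d = F) :
    R.faceLength (R.faceOf (R.outerDart m d)) = if m = 1 then 5 else 6 := by
  split_ifs with hm1
  · exact h.faceLength_eq_five_of_mem_layer_one (hm1 ▸ R.faceOf_outerDart_mem_layer hd m)
  · exact h.faceLength_layer m (by lia) hmn _ (faceOf_outerDart_mem_layer hd m)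

theorem eq_of_faceOf_outerDart_eq (h : R.IsCap F n) (hm : m ≠ 0) (hmn : m ≤ n)
    (hd : R.faceOf d = F) (he : R.faceOf e = F)
    (hde : R.faceOf (R.outerDart m d) = R.faceOf (R.outerDart 1 e)) : m = 1 ∧ d = e := by
  have hm1 : m = 1 := by
    by_contra hm1
    have hlen := h.faceLength_outerDart hm hmn hd
    rw [hde, h.faceLength_outerDart one_ne_zero (by lia) he] at hlen
    simp [hm1] at hlen
  subst hm1
  rw [faceOf_outerDart_succ, faceOf_outerDart_succ] at hde
  exact ⟨rfl, injOn_faceOf_symm h.faceLength_center_ne_zero h.ncard_fiveFacesAround_eq hd he hde⟩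

theorem five_dvd_of_iterate_facePerm_outerDart_eq (h : R.IsCap F n) {i : ℕ} (hm : m ≠ 0)
    (hmn : m ≤ n) (hd : R.faceOf d = F) (he : R.faceOf e = F)
    (hi : R.facePerm^[i] (R.outerDart m d) = R.outerDart 1 e) : 5 ∣ i := by
  obtain ⟨rfl, rfl⟩ := h.eq_of_faceOf_outerDart_eq hm hmn hd he (by
    rw [← hi, Equiv.Perm.iterate_eq_pow, ← zpow_natCast, faceOf_facePerm_zpow])
  exact (iterate_facePerm_eq_self_iff (h.faceLength_outerDart hm hmn hd)).1 hi

theorem facePerm_outerDart (h : R.IsCap F n) (hmn : m + 1 ≤ n) (hd : R.faceOf d = F) :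
    R.facePerm (R.facePerm (R.facePerm (R.outerDart (m + 1) d))) = (R.outerDart m d).symm := by
  have hlen := h.faceLength_outerDart m.succ_ne_zero hmn hd
  rw [faceOf_outerDart_succ] at hlen
  match m with
  | 0 => exact (iterate_facePerm_eq_self_iff (i := 5) (n := 5) hlen).2 dvd_rfl
  | m + 1 => exact (iterate_facePerm_eq_self_iff (i := 6) (n := 6) hlen).2 dvd_rfl

theorem eq_or_of_faceOf_eq_outerDart (h : R.IsCap F n) (hmn : m + 1 ≤ n) (hd : R.faceOf d = F)
    (he : R.faceOf e = R.faceOf (R.outerDart (m + 1) d)) :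
    e = R.outerDart (m + 1) d ∨ e = R.facePerm (R.outerDart (m + 1) d) ∨
      e = R.facePerm (R.facePerm (R.outerDart (m + 1) d)) ∨
      e = R.facePerm.symm (R.outerDart (m + 1) d) ∨ e = (R.outerDart m d).symm ∨
      m ≠ 0 ∧ e = R.facePerm (R.outerDart m d).symm := by
  have hlen := h.faceLength_outerDart m.succ_ne_zero hmn hd
  rw [← h.facePerm_outerDart hmn hd]
  match m with
  | 0 =>
    have := eq_or_of_faceLength_eq_five hlen he
    tauto
  | m + 1 =>
    have := eq_or_of_faceLength_eq_six (by simpa using hlen) he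
    simp only [ne_eq, Nat.succ_ne_zero, not_false_eq_true, true_and]
    tauto

section Cubic

variable (hR : R.rot ^ 3 = 1)

include hR

theorem outerDart_facePerm (h : R.IsCap F n) (hm : m ≠ 0) (hmn : m ≤ n) (hd : R.faceOf d = F) :
    R.outerDart m (R.facePerm d) = R.boundaryShift (R.outerDart m d) := by
  obtain ⟨m, rfl⟩ := Nat.exists_eq_succ_of_ne_zero hm
  induction m with
  | zero =>
    rw [boundaryShift_eq_of_facePerm_eq hR (h.facePerm_outerDart hmn hd)]
    rfl
  | succ m ih =>
    rw [boundaryShift_eq_of_facePerm_eq hR (h.facePerm_outerDart hmn hd),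
      ← oppositeDart_boundaryShift, ← ih m.succ_ne_zero (by lia)]
    rfl

theorem outerDart_facePerm_inv (h : R.IsCap F n) (hm : m ≠ 0) (hmn : m ≤ n)
    (hd : R.faceOf d = F) :
    R.outerDart m (R.facePerm.symm d) = R.boundaryShift.symm (R.outerDart m d) := by
  rw [Equiv.eq_symm_apply, ← h.outerDart_facePerm hR hm hmn (by simpa using hd),
    Equiv.apply_symm_apply]

theorem outerDart_facePerm_zpow (h : R.IsCap F n) (hm : m ≠ 0) (hmn : m ≤ n)
    (hd : R.faceOf d = F) (i : ℤ) :
    R.outerDart m ((R.facePerm ^ i) d) = (R.boundaryShift ^ i) (R.outerDart m d) := by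
  induction i using Int.induction_on with
  | zero => rfl
  | succ i ih =>
    rw [add_comm, zpow_one_add, zpow_one_add, Equiv.Perm.mul_apply, Equiv.Perm.mul_apply, ← ih]
    exact h.outerDart_facePerm hR hm hmn ((R.faceOf_facePerm_zpow _ d).trans hd)
  | pred i ih =>
    rw [sub_eq_neg_add, zpow_add, zpow_add, zpow_neg_one, zpow_neg_one, Equiv.Perm.mul_apply,
      Equiv.Perm.mul_apply, ← ih]
    exact h.outerDart_facePerm_inv hR hm hmn ((R.faceOf_facePerm_zpow _ d).trans hd)

-- The shift is conjugated to its inverse by reversal, so that a gluing of two layer boundaries is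
-- a reflection; according to the parity of the displacement it fixes a vertex or an edge.
theorem exists_outerDart_symm_eq (h : R.IsCap F n) {k : ℕ} (hm : m ≠ 0) (hmn : m ≤ n)
    (hk : k ≠ 0) (hkn : k ≤ n) (hd : R.faceOf d = F) (he : R.faceOf e = F)
    (hde : (R.outerDart m d).symm = R.outerDart k e) :
    ∃ c, R.faceOf c = F ∧ ((R.outerDart m c).symm = R.outerDart k c ∨
      (R.outerDart m c).symm = R.boundaryShift (R.outerDart k c)) := by
  obtain ⟨j, rfl⟩ := R.faceOf_eq_iff.1 (hd.trans he.symm)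
  have key (i : ℤ) : (R.outerDart m ((R.facePerm ^ i) d)).symm =
      (R.boundaryShift ^ (j - i - i)) (R.outerDart k ((R.facePerm ^ i) d)) := by
    rw [h.outerDart_facePerm_zpow hR hm hmn hd, h.outerDart_facePerm_zpow hR hk hkn hd,
      boundaryShift_zpow_symm, hde, h.outerDart_facePerm_zpow hR hk hkn hd,
      ← Equiv.Perm.mul_apply, ← Equiv.Perm.mul_apply, ← zpow_add, ← zpow_add]
    congr 2
    ring
  obtain ⟨i, hi⟩ := Int.even_or_odd' j
  refine ⟨(R.facePerm ^ i) d, (R.faceOf_facePerm_zpow i d).trans hd,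
    hi.imp (fun hj => ?_) fun hj => ?_⟩
  · rw [key, hj, show 2 * i - i - i = 0 by ring, zpow_zero, Equiv.Perm.one_apply]
  · rw [key, hj, show 2 * i + 1 - i - i = 1 by ring, zpow_one]

theorem outerDart_symm_ne {j k : ℕ} (h : R.IsCap F n) (hk : k ≠ 0) (hkn : k + j ≤ n)
    (hd : R.faceOf d = F) (he : R.faceOf e = F) :
    (R.outerDart (k + j) d).symm ≠ R.outerDart k e := by
  intro hde
  induction j using Nat.twoStepInduction generalizing k with
  | zero =>
    obtain ⟨c, -, hc | hc⟩ := h.exists_outerDart_symm_eq hR hk hkn hk hkn hd he hde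
    · exact SimpleGraph.Dart.symm_ne _ hc
    · exact R.boundaryShift_ne_symm _ hc.symm
  | one =>
    obtain ⟨c, hcF, hc⟩ := h.exists_outerDart_symm_eq hR k.succ_ne_zero hkn hk (by lia) hd he hde
    have hstraight := h.facePerm_outerDart hkn hcF
    rcases hc with hc | hc
    · rw [← hc, symm_symm] at hstraight
      have hlen := h.faceLength_outerDart k.succ_ne_zero hkn hcF
      simp only [Nat.succ_eq_add_one, Nat.add_eq_right, hk, if_false] at hlen
      have := (iterate_facePerm_eq_self_iff (i := 3) hlen).1 hstraight
      lia
    · apply boundaryShift_ne_facePerm_facePerm_facePerm hR (R.outerDart (k + 1) c)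
      rw [hstraight, ← symm_symm (R.outerDart (k + 1) c), hc, boundaryShift_symm_boundaryShift]
  | more j ih _ =>
    refine ih k.succ_ne_zero (by lia) ?_
    rw [outerDart_succ hk, ← hde, oppositeDart, symm_symm, show k + 1 + j = k + j + 1 by lia]
    exact (h.facePerm_outerDart (m := k + j + 1) hkn hd).symm

theorem faceOf_outerDart_ne_center (h : R.IsCap F n) (hm : m ≠ 0) (hmn : m ≤ n)
    (hd : R.faceOf d = F) : R.faceOf (R.outerDart m d) ≠ F := by
  intro hF
  let e := R.facePerm (R.facePerm (R.outerDart m d))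
  have hpentagon : R.faceOf (R.outerDart m (R.facePerm d)) = R.faceOf (R.outerDart 1 e) := by
    rw [h.outerDart_facePerm hR hm hmn hd, ← faceOf_symm_facePerm_facePerm hR,
      faceOf_outerDart_succ]
    rfl
  obtain ⟨rfl, -⟩ := h.eq_of_faceOf_outerDart_eq hm hmn (by simpa using hd)
    (by simpa [e] using hF) hpentagon
  have hlen := h.faceLength_outerDart hm hmn hd
  simp [hF, h.faceLength_center] at hlen

theorem faceOf_symm_outerDart_ne (h : R.IsCap F n) (hm : m ≠ 0) (hmn : m ≤ n)
    (hd : R.faceOf d = F) (he : R.faceOf e = F) :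
    R.faceOf (R.outerDart m d).symm ≠ R.faceOf (R.outerDart 1 e) := by
  intro hde
  have h1n : 1 ≤ n := by lia
  have hshift := h.outerDart_facePerm hR one_ne_zero h1n he
  have hd_pred : R.faceOf (R.facePerm.symm d) = F := by simpa using hd
  have he_succ : R.faceOf (R.facePerm e) = F := by simpa using he
  have he_pred : R.faceOf (R.facePerm.symm e) = F := by simpa using he
  have hlen {c : G.Dart} (hc : R.faceOf c = F) : R.faceLength (R.faceOf (R.outerDart 1 c)) = 5 :=
    h.faceLength_outerDart one_ne_zero h1n hc
  rcases eq_or_of_faceLength_eq_five (hlen he) hde with hq | hq | hq | hq | hq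
  · obtain ⟨j, rfl⟩ := Nat.exists_eq_add_of_le (Nat.one_le_iff_ne_zero.2 hm)
    exact h.outerDart_symm_ne hR one_ne_zero hmn hd he hq
  · have hgap : R.facePerm (R.facePerm (R.outerDart m (R.facePerm.symm d))) =
        R.outerDart 1 (R.facePerm e) := by
      rw [h.outerDart_facePerm_inv hR hm hmn hd, ← symm_facePerm_inv hR, hshift,
        ← symm_symm (R.outerDart m d), hq, ← facePerm_symm_boundaryShift,
        Equiv.symm_apply_apply, symm_symm]
    simpa using h.five_dvd_of_iterate_facePerm_outerDart_eq (i := 2) hm hmn hd_pred he_succ hgap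
  · have hgap : R.facePerm (R.outerDart m d) = R.outerDart 1 (R.facePerm e) := by
      rw [hshift, boundaryShift_apply hR, ← hq, symm_symm]
    simpa using h.five_dvd_of_iterate_facePerm_outerDart_eq (i := 1) hm hmn hd he_succ hgap
  · rw [h.facePerm_outerDart h1n he] at hq
    apply h.faceOf_outerDart_ne_center hR hm hmn hd
    rwa [SimpleGraph.Dart.symm_involutive.injective hq]
  · have hgap : R.outerDart m d =
        R.facePerm (R.facePerm (R.outerDart 1 (R.facePerm.symm e))) := by
      rw [h.outerDart_facePerm_inv hR one_ne_zero h1n he, ← symm_facePerm_inv hR, ← hq, symm_symm]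
    have hgap' : R.facePerm^[3] (R.outerDart m d) = R.outerDart 1 (R.facePerm.symm e) := by
      rw [hgap]
      exact (iterate_facePerm_eq_self_iff (i := 5) (hlen he_pred)).2 dvd_rfl
    simpa using h.five_dvd_of_iterate_facePerm_outerDart_eq hm hmn hd he_pred hgap'

theorem disjoint_layer_one (h : R.IsCap F n) (hm : m ≠ 0) (hmn : m ≤ n) :
    Disjoint (R.layer F 1) (R.layer F (m + 1)) := by
  rw [Set.disjoint_left]
  rintro _ ⟨e, he, rfl⟩ ⟨d, hd, hde⟩
  exact h.faceOf_symm_outerDart_ne hR hm hmn hd he ((R.faceOf_outerDart_succ m d).symm.trans hde)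

theorem exists_mem_layer_of_adj (h : R.IsCap F n) (hmn : m ≤ n) (hf : f ∈ R.layer F m)
    (hfg : R.dual.Adj f g) : ∃ l ≤ m + 1, g ∈ R.layer F l := by
  obtain ⟨d, hd, rfl⟩ := hf
  obtain ⟨-, e, he, rfl⟩ := hfg
  have hsucc : R.faceOf (R.facePerm d) = F := by simpa using hd
  have hpred : R.faceOf (R.facePerm.symm d) = F := by simpa using hd
  match m with
  | 0 => exact ⟨1, le_rfl, faceOf_symm_outerDart_mem_layer (he.trans hd) 0⟩
  | m + 1 =>
    have hm := m.succ_ne_zero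
    rcases h.eq_or_of_faceOf_eq_outerDart hmn hd he with rfl | rfl | rfl | rfl | rfl | ⟨hm', rfl⟩
    · exact ⟨m + 2, le_rfl, faceOf_symm_outerDart_mem_layer hd _⟩
    · rw [faceOf_symm_facePerm, ← h.outerDart_facePerm hR hm hmn hd]
      exact ⟨m + 2, le_rfl, faceOf_symm_outerDart_mem_layer hsucc _⟩
    · rw [faceOf_symm_facePerm_facePerm hR, ← h.outerDart_facePerm hR hm hmn hd]
      exact ⟨m + 1, by lia, faceOf_outerDart_mem_layer hsucc _⟩
    · rw [faceOf_symm_facePerm_inv hR, ← h.outerDart_facePerm_inv hR hm hmn hd]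
      exact ⟨m + 1, by lia, faceOf_outerDart_mem_layer hpred _⟩
    · rw [symm_symm]
      exact ⟨m, by lia, faceOf_outerDart_mem_layer hd _⟩
    · rw [faceOf_symm_facePerm, boundaryShift_symm, symm_symm,
        ← h.outerDart_facePerm_inv hR hm' (by lia) hd]
      exact ⟨m, by lia, faceOf_outerDart_mem_layer hpred _⟩

theorem exists_mem_layer_of_walk (h : R.IsCap F n) (w : R.dual.Walk f F) (hw : w.length ≤ n + 1) :
    ∃ m ≤ w.length, f ∈ R.layer F m := by
  induction w with
  | nil => exact ⟨0, le_rfl, by simp [layer_zero]⟩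
  | cons hadj w ih =>
    rw [SimpleGraph.Walk.length_cons] at hw ⊢
    obtain ⟨m, hm, hmem⟩ := ih h (by lia)
    obtain ⟨l, hl, hmem'⟩ := h.exists_mem_layer_of_adj hR (by lia) hmem hadj.symm
    exact ⟨l, by lia, hmem'⟩

theorem faceOf_symm_outerDart_eq_of_adj (h : R.IsCap F n) (hn : n ≠ 0) (hd : R.faceOf d = F)
    (hg : ∀ m ≤ n + 1, g ∉ R.layer F m)
    (hlen : R.faceLength (R.faceOf (R.outerDart (n + 1) d)) = 5)
    (hadj : R.dual.Adj (R.faceOf (R.outerDart (n + 1) d)) g) :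
    R.faceOf (R.outerDart (n + 1) d).symm = g := by
  obtain ⟨-, e, he, rfl⟩ := hadj
  rw [faceOf_outerDart_succ] at hlen he
  have hsucc : R.faceOf (R.facePerm d) = F := by simpa using hd
  have hpred : R.faceOf (R.facePerm.symm d) = F := by simpa using hd
  rcases eq_or_of_faceLength_eq_five hlen he with rfl | rfl | rfl | rfl | rfl
  · refine absurd ?_ (hg n n.le_succ)
    rw [symm_symm]
    exact faceOf_outerDart_mem_layer hd n
  · refine absurd ?_ (hg n n.le_succ)
    rw [faceOf_symm_facePerm, boundaryShift_symm, symm_symm,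
      ← h.outerDart_facePerm_inv hR hn le_rfl hd]
    exact faceOf_outerDart_mem_layer hpred n
  · refine absurd ?_ (hg (n + 1) le_rfl)
    rw [faceOf_symm_facePerm_facePerm hR, boundaryShift_symm,
      ← h.outerDart_facePerm_inv hR hn le_rfl hd]
    exact faceOf_symm_outerDart_mem_layer hpred n
  · rw [outerDart_succ hn, oppositeDart]
  · refine absurd ?_ (hg (n + 1) le_rfl)
    rw [← facePerm_symm_facePerm_symm hR, faceOf_facePerm, faceOf_symm_facePerm,
      ← h.outerDart_facePerm hR hn le_rfl hd]
    exact faceOf_symm_outerDart_mem_layer hsucc n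

theorem adj_faceOf_outerDart_facePerm (h : R.IsCap F n) (hn : n ≠ 0) (hd : R.faceOf d = F)
    (hg : ∀ m ≤ n + 1, g ∉ R.layer F m) (hfive : ∀ f, R.dual.Adj g f → R.faceLength f = 5)
    (hadj : R.dual.Adj (R.faceOf (R.outerDart (n + 1) d)) g) :
    R.dual.Adj (R.faceOf (R.outerDart (n + 1) (R.facePerm d))) g := by
  have hlen := hfive _ hadj.symm
  have hnext : R.faceOf (R.outerDart (n + 1) (R.facePerm d)).symm = g := by
    rw [← h.faceOf_symm_outerDart_eq_of_adj hR hn hd hg hlen hadj, outerDart_succ hn,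
      outerDart_succ hn, h.outerDart_facePerm hR hn le_rfl hd]
    rw [faceOf_outerDart_succ] at hlen
    exact faceOf_symm_oppositeDart_boundaryShift hR hlen
  rcases R.faceOf_eq_or_dual_adj (R.outerDart (n + 1) (R.facePerm d)) with heq | hadj'
  · refine absurd ?_ (hg (n + 1) le_rfl)
    rw [← hnext, ← heq]
    exact faceOf_outerDart_mem_layer (by simpa using hd) _
  · rwa [hnext] at hadj'

theorem faceLength_eq_five_of_adj (h : R.IsCap F n) (hn : n ≠ 0)
    (hg : ∀ m ≤ n + 1, g ∉ R.layer F m) (hfive : ∀ f, R.dual.Adj g f → R.faceLength f = 5)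
    {f₀ : R.Face} (hf₀ : f₀ ∈ R.layer F (n + 1)) (hadj : R.dual.Adj f₀ g)
    (hf : f ∈ R.layer F (n + 1)) : R.faceLength f = 5 := by
  obtain ⟨d, hd, rfl⟩ := hf₀
  obtain ⟨e, he, rfl⟩ := hf
  have hlen : R.faceLength (R.faceOf d) = 6 := hd ▸ h.faceLength_center
  obtain ⟨i, -, rfl⟩ := exists_iterate_facePerm_eq hlen (he.trans hd.symm)
  clear he
  refine hfive _ (SimpleGraph.Adj.symm ?_)
  induction i generalizing d with
  | zero => exact hadj
  | succ _ ih =>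
    refine ih (R.facePerm d) (by simpa using hd)
      (h.adj_faceOf_outerDart_facePerm hR hn hd hg hfive hadj) (by simpa using hlen)

end Cubic

end IsCap

/-! ### Drums -/

section Drum

variable {R} [Fintype V] [DecidableRel G.Adj] {k l : ℕ} {F F' f : R.Face}

theorem IsDrum.adj_or_adj (h : R.IsDrum F F') (hf : R.faceLength f = 5) :
    R.dual.Adj F f ∨ R.dual.Adj F' f := by
  have : Finite R.Face := Quotient.finite _
  have hall : R.fiveFacesAround F ∪ R.fiveFacesAround F' = {f | R.faceLength f = 5} := by
    refine Set.eq_of_subset_of_ncard_le (Set.union_subset (fun _ h => h.2) fun _ h => h.2) ?_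
    rw [Set.ncard_union_eq h.disjoint, h.card_left, h.card_right,
      h.fullerene.ncard_faceLength_eq_five]
  exact (hall.ge hf).imp And.left And.left

namespace IsKDrum

variable (h : R.IsKDrum k F F')

include h

theorem rot_pow_three : R.rot ^ 3 = 1 :=
  R.rot_pow_eq_one_of_isRegularOfDegree h.drum.fullerene.cubic

theorem dual_preconnected : R.dual.Preconnected :=
  R.dual_preconnected h.drum.fullerene.plane.1.preconnected

theorem faceLength_eq_five_of_adj_right (hf : R.dual.Adj F' f) : R.faceLength f = 5 :=
  R.faceLength_eq_five_of_adj (by simp [h.drum.length_right])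
    (h.drum.card_right.trans h.drum.length_right.symm) hf

theorem right_notMem_layer (hl : l ≤ k) : F' ∉ R.layer F l := by
  intro hmem
  obtain ⟨w, hw⟩ := exists_walk_of_mem_layer hmem
  have hdist := SimpleGraph.dist_le w.reverse
  rw [SimpleGraph.Walk.length_reverse, ← facialDist, h.dist_eq] at hdist
  lia

theorem le_of_mem_layer_of_adj (hf : f ∈ R.layer F l) (hadj : R.dual.Adj F' f) : k ≤ l := by
  obtain ⟨w, hw⟩ := exists_walk_of_mem_layer hf
  have hdist := SimpleGraph.dist_le (SimpleGraph.Walk.cons hadj w).reverse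
  rw [SimpleGraph.Walk.length_reverse, SimpleGraph.Walk.length_cons, ← facialDist,
    h.dist_eq] at hdist
  lia

theorem isCap_of_le {n : ℕ} (hn : n ≤ k - 1) : R.IsCap F n := by
  have hF := h.drum.length_left
  have hR := h.rot_pow_three
  induction n with
  | zero => exact ⟨hF, h.drum.card_left, fun m hm hm0 => by lia⟩
  | succ n ih =>
    have hcap := ih (by lia)
    refine ⟨hF, h.drum.card_left, fun m hm hmn f hf => ?_⟩
    rcases hmn.lt_or_eq with hlt | rfl
    · exact hcap.faceLength_layer m hm (by lia) f hf
    refine (h.drum.fullerene.faceLength_eq f).resolve_left fun hf5 => ?_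
    rcases h.drum.adj_or_adj hf5 with hadj | hadj
    · have hf1 : f ∈ R.layer F 1 := hcap.layer_one.ge ⟨hadj, hf5⟩
      exact Set.disjoint_left.1 (hcap.disjoint_layer_one hR (by lia) le_rfl) hf1 hf
    · exact absurd (h.le_of_mem_layer_of_adj hf hadj) (by lia)

theorem exists_mem_layer_adj (hk : k ≠ 0) : ∃ f ∈ R.layer F k, R.dual.Adj f F' := by
  obtain ⟨w, hw⟩ := (h.dual_preconnected F' F).exists_walk_length_eq_dist
  rw [SimpleGraph.dist_comm, ← facialDist, h.dist_eq] at hw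
  cases w with
  | nil => simp at hw
  | @cons _ f _ hadj w =>
    rw [SimpleGraph.Walk.length_cons, Nat.add_right_cancel_iff] at hw
    obtain ⟨m, hm, hf⟩ := (h.isCap_of_le le_rfl).exists_mem_layer_of_walk
      h.rot_pow_three w (by lia)
    obtain rfl : m = k := (hm.trans hw.le).antisymm (h.le_of_mem_layer_of_adj hf hadj)
    exact ⟨f, hf, hadj.symm⟩

theorem mem_layer_of_facialDist_eq (hl : l ≤ k) (hf : R.facialDist F f = l) :
    f ∈ R.layer F l := by
  obtain ⟨w, hw⟩ := (h.dual_preconnected f F).exists_walk_length_eq_dist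
  rw [SimpleGraph.dist_comm, ← facialDist, hf] at hw
  obtain ⟨m, hm, hmem⟩ :=
    (h.isCap_of_le le_rfl).exists_mem_layer_of_walk h.rot_pow_three w (by lia)
  obtain ⟨w', hw'⟩ := exists_walk_of_mem_layer hmem
  have hdist := SimpleGraph.dist_le w'.reverse
  rw [SimpleGraph.Walk.length_reverse, ← facialDist, hf] at hdist
  obtain rfl : m = l := (hm.trans hw.le).antisymm (hdist.trans hw')
  exact hmem

theorem faceLength_eq_of_mem_layer (hl₀ : l ≠ 0) (hl : l ≤ k) (hf : f ∈ R.layer F l) :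
    R.faceLength f = if l = 1 ∨ l = k then 5 else 6 := by
  have hcap := h.isCap_of_le le_rfl
  by_cases hl₁ : l = 1
  · subst hl₁
    simpa using hcap.faceLength_eq_five_of_mem_layer_one hf
  rcases hl.lt_or_eq with hlt | rfl
  · rw [if_neg (by lia)]
    exact hcap.faceLength_layer l (by lia) (by lia) f hf
  · rw [if_pos (.inr rfl)]
    obtain ⟨f₀, hf₀, hadj⟩ := h.exists_mem_layer_adj hl₀
    obtain ⟨n, rfl⟩ := Nat.exists_eq_succ_of_ne_zero hl₀
    exact hcap.faceLength_eq_five_of_adj h.rot_pow_three (by lia)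
      (fun m hm => h.right_notMem_layer hm) (fun _ => h.faceLength_eq_five_of_adj_right)
      hf₀ hadj hf

end IsKDrum

end Drum

end RotationSystem

theorem mainTheorem7 {V : Type*} [Fintype V] (G : SimpleGraph V) [DecidableRel G.Adj]
    (R : RotationSystem G) (k : ℕ) (F F' : R.Face) (hdrum : R.IsKDrum k F F')
    (l : ℕ) (hl : l ≤ k) (f g : R.Face)
    (hf : R.facialDist F f = l) (hg : R.facialDist F g = l) :
    R.faceLength f = R.faceLength g := by
  have hf := hdrum.mem_layer_of_facialDist_eq hl hf
  have hg := hdrum.mem_layer_of_facialDist_eq hl hg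
  by_cases hl₀ : l = 0
  · rw [hl₀, RotationSystem.layer_zero] at hf hg
    rw [hf, hg]
  · rw [hdrum.faceLength_eq_of_mem_layer hl₀ hl hf, hdrum.faceLength_eq_of_mem_layer hl₀ hl hg]
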